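/- Let $G$ be a compact Hausdorff topological group with a countable basis, and let $\mu=(\mu_k)_{k\in-\mathbb N}$, $-\mathbb N=\{0,-1,-2,\dots\}$, be a family of Borel probability measures on $G$. A \emph{solution} (with noise law $\mu$) is a pair of $G$-valued processes $\{(\eta_k)_{k\in-\mathbb N},(\xi_k)_{k\in-\mathbb N}\}$ on a common probability space such that, for every $k\in-\mathbb N$, $\eta_k=\xi_k\eta_{k-1}$ almost surely, $\xi_k$ is independent of $\sigma(\eta_m:m\le k-1)$, and $\xi_k$ has law $\mu_k$. Let $\mathscr P_\mu$ be the set of the laws on $G^{-\mathbb N}$ of $(\eta_k)$ for all solutions; it is a convex set of probability measures. A solution is \emph{extremal} if the law of $(\eta_k)$ is an extreme point of $\mathscr P_\mu$. For a solution $\{(\eta^0_k),(\xi_k)\}$, a deterministic sequence $(\alpha_l)_{l\in-\mathbb N}$ in $G$ and a compact subgroup $H$ of $G$, consider the following conditions, where $G/H$ is the space of left cosets $gH$ with the quotient topology and all limits are taken as $l\to-\infty$: (E1) for each $k\in-\mathbb N$, $\xi_k\xi_{k-1}\cdots\xi_l\,\alpha_l\to\eta^0_k$ in distribution; (E2) $\alpha_l^{-1}\eta^0_{l-1}\to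 U_H$ in distribution, where the law of $U_H$ is the normalized Haar measure of $H$; (E3) for each $h\in H$ and each $k\in-\mathbb N$, $\eta^0_kh$ and $\eta^0_k$ have the same law; (E4) for each $k\in-\mathbb N$, $\xi_k\xi_{k-1}\cdots\xi_l\,\alpha_lH\to\eta^0_kH$ almost surely in $G/H$. Then the following statements hold. (i) If a solution $\{(\eta^0_k),(\xi_k)\}$ satisfies (E1) with some sequence $(\alpha_l)$, then it is extremal. (ii) If a solution $\{(\eta^0_k),(\xi_k)\}$ satisfies (E1), (E3) and (E4) for some $(\alpha_l)$ and some compact subgroup $H$, then it also satisfies (E2) with the same $(\alpha_l)$ and $H$. -/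

import Mathlib

open MeasureTheory ProbabilityTheory Filter Topology
open scoped NNReal

/-! A process indexed by the non-positive integers `0, -1, -2, …` is written as a sequence
indexed by `ℕ`: the value at the index `n : ℕ` is the value at time `-n`.  Thus time `k - 1`
is the index `k + 1`, and `l → -∞` is `atTop` on `ℕ`. -/

namespace StochEq

universe u v

/-- The σ-field generated by the values of `η` up to time `-k`. -/
abbrev pastField {G : Type u} [MeasurableSpace G] {Ω : Type v} (η : ℕ → Ω → G) (k : ℕ) :
    MeasurableSpace Ω :=
  ⨆ m : ℕ, ⨆ _ : k ≤ m, MeasurableSpace.comap (η m) inferInstance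

/-- The pair of processes `(η, ξ)` on `(Ω, P)` is a solution of `η_k = ξ_k η_{k-1}` with noise
law `μ`. -/
structure IsSolution {G : Type u} [Group G] [MeasurableSpace G]
    {Ω : Type v} [MeasurableSpace Ω] (P : Measure Ω) (μ : ℕ → ProbabilityMeasure G)
    (η ξ : ℕ → Ω → G) : Prop where
  measurable_eta : ∀ k, Measurable (η k)
  measurable_xi : ∀ k, Measurable (ξ k)
  equation : ∀ k, ∀ᵐ ω ∂P, η k ω = ξ k ω * η (k + 1) ω
  indep : ∀ k, Indep (MeasurableSpace.comap (ξ k) inferInstance) (pastField η (k + 1)) P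
  noise_law : ∀ k, P.map (ξ k) = (μ k : Measure G)

/-- The law of the process `η` on the sequence space. -/
noncomputable def pathLaw {G : Type u} [MeasurableSpace G] {Ω : Type v} [MeasurableSpace Ω]
    (P : Measure Ω) (η : ℕ → Ω → G) : Measure (ℕ → G) :=
  P.map (fun ω k => η k ω)

/-- The set of the laws of `η` for all solutions `(η, ξ)` with noise law `μ`, on all probability
spaces.  The universe of the probability spaces is immaterial; see `pathLaw_mem_solutionLaws`. -/
def solutionLaws {G : Type u} [Group G] [MeasurableSpace G] (μ : ℕ → ProbabilityMeasure G) :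
    Set (Measure (ℕ → G)) :=
  {Q | ∃ (Ω : Type u) (_ : MeasurableSpace Ω) (P : Measure Ω) (_ : IsProbabilityMeasure P)
      (η ξ : ℕ → Ω → G), IsSolution P μ η ξ ∧ pathLaw P η = Q}

/-- The solution with first component `η` is extremal: the law of `η` is an extreme point of the
set of solution laws, for the usual convex structure (mixtures `a • Q₁ + b • Q₂`). -/
def IsExtremal {G : Type u} [Group G] [MeasurableSpace G] {Ω : Type v} [MeasurableSpace Ω]
    (P : Measure Ω) (μ : ℕ → ProbabilityMeasure G) (η : ℕ → Ω → G) : Prop :=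
  pathLaw P η ∈ Set.extremePoints ℝ≥0 (solutionLaws μ)

/-- `ξ_k ξ_{k-1} ⋯ ξ_l`, where the indices `k ≤ l` in `ℕ` stand for the times `-k ≥ -l`. -/
def noiseProd {G : Type u} [Group G] {Ω : Type v} (ξ : ℕ → Ω → G) (k l : ℕ) (ω : Ω) : G :=
  ((List.Ico k (l + 1)).map (fun i => ξ i ω)).prod

/-- `ξ_k ξ_{k-1} ⋯ ξ_l α_l → η_k` in law as `l → -∞`, for each `k`. -/
def CondE1 {G : Type u} [Group G] [TopologicalSpace G] [MeasurableSpace G] [BorelSpace G]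
    {Ω : Type v} [MeasurableSpace Ω] (P : Measure Ω) [IsProbabilityMeasure P]
    (η ξ : ℕ → Ω → G) (α : ℕ → G) : Prop :=
  ∀ k, TendstoInDistribution (fun l ω => noiseProd ξ k l ω * α l) atTop (η k) (fun _ => P) P

/-- The normalized Haar measure of a compact group. -/
noncomputable def normalizedHaar (K : Type u) [Group K] [TopologicalSpace K]
    [IsTopologicalGroup K] [CompactSpace K] [MeasurableSpace K] [BorelSpace K] : Measure K :=
  Measure.haarMeasure (⊤ : TopologicalSpace.PositiveCompacts K)

instance isProbabilityMeasure_normalizedHaar (K : Type u) [Group K] [TopologicalSpace K]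
    [IsTopologicalGroup K] [CompactSpace K] [MeasurableSpace K] [BorelSpace K] :
    IsProbabilityMeasure (normalizedHaar K) :=
  ⟨by
    have h := Measure.haarMeasure_self (K₀ := (⊤ : TopologicalSpace.PositiveCompacts K))
    rwa [TopologicalSpace.PositiveCompacts.coe_top] at h⟩

/-- `α_l⁻¹ η_{l-1} → U_H` in law as `l → -∞`.  The limit `U_H` is realized as the inclusion of
`H` in `G` on the probability space `H` with its normalized Haar measure. -/
def CondE2 {G : Type u} [Group G] [TopologicalSpace G] [IsTopologicalGroup G]
    [MeasurableSpace G] [BorelSpace G]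
    {Ω : Type v} [MeasurableSpace Ω] (P : Measure Ω) [IsProbabilityMeasure P]
    (η : ℕ → Ω → G) (α : ℕ → G) (H : Subgroup G) [CompactSpace H] : Prop :=
  TendstoInDistribution (fun l ω => (α l)⁻¹ * η (l + 1) ω) atTop
    (fun h : H => (h : G)) (fun _ => P) (normalizedHaar H)

/-- `η_k h` and `η_k` have the same law, for each `h ∈ H` and each `k`. -/
def CondE3 {G : Type u} [Group G] [MeasurableSpace G]
    {Ω : Type v} [MeasurableSpace Ω] (P : Measure Ω)
    (η : ℕ → Ω → G) (H : Subgroup G) : Prop :=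
  ∀ h ∈ H, ∀ k, P.map (fun ω => η k ω * h) = P.map (η k)

/-- `ξ_k ξ_{k-1} ⋯ ξ_l α_l H → η_k H` almost surely in `G ⧸ H` (the space of left cosets `gH`
with the quotient topology) as `l → -∞`, for each `k`. -/
def CondE4 {G : Type u} [Group G] [TopologicalSpace G]
    {Ω : Type v} [MeasurableSpace Ω] (P : Measure Ω)
    (η ξ : ℕ → Ω → G) (α : ℕ → G) (H : Subgroup G) : Prop :=
  ∀ k, ∀ᵐ ω ∂P, Tendsto (fun l => ((noiseProd ξ k l ω * α l : G) : G ⧸ H)) atTop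
    (𝓝 ((η k ω : G) : G ⧸ H))

/-- The law of every solution, on a probability space in any universe, is a solution law. -/
theorem pathLaw_mem_solutionLaws {G : Type u} [Group G] [MeasurableSpace G] [MeasurableEq G]
    [MeasurableMul₂ G]
    {Ω : Type v} [MeasurableSpace Ω] (P : Measure Ω) [IsProbabilityMeasure P]
    (μ : ℕ → ProbabilityMeasure G) (η ξ : ℕ → Ω → G) (h : IsSolution P μ η ξ) :
    pathLaw P η ∈ solutionLaws μ := by
  have hm : Measurable (fun ω => ((fun k => η k ω, fun k => ξ k ω) : (ℕ → G) × (ℕ → G))) :=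
    (measurable_pi_lambda _ h.measurable_eta).prodMk (measurable_pi_lambda _ h.measurable_xi)
  have e1 : ∀ k, Measurable (fun p : (ℕ → G) × (ℕ → G) => p.1 k) := fun k => by fun_prop
  have e2 : ∀ k, Measurable (fun p : (ℕ → G) × (ℕ → G) => p.2 k) := fun k => by fun_prop
  refine ⟨(ℕ → G) × (ℕ → G), inferInstance, P.map _, Measure.isProbabilityMeasure_map hm.aemeasurable,
    fun k p => p.1 k, fun k p => p.2 k, ⟨e1, e2, fun k => ?_, fun k => ?_, fun k => ?_⟩, ?_⟩
  · exact (ae_map_iff hm.aemeasurable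
      (measurableSet_eq_fun (e1 k) ((e2 k).mul (e1 (k + 1))))).2 (h.equation k)
  · have hpast : pastField (fun (k : ℕ) (p : (ℕ → G) × (ℕ → G)) => p.1 k) (k + 1) ≤
        (inferInstance : MeasurableSpace ((ℕ → G) × (ℕ → G))) :=
      iSup₂_le fun m _ => (e1 m).comap_le
    rw [Indep_iff]
    intro s t hs ht
    have hs' := (e2 k).comap_le s hs
    have ht' := hpast t ht
    rw [Measure.map_apply hm (hs'.inter ht'), Measure.map_apply hm hs', Measure.map_apply hm ht']
    refine (Indep_iff _ _ _).1 (h.indep k) _ _ ?_ ?_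
    · obtain ⟨A, hA, rfl⟩ := hs
      exact ⟨A, hA, rfl⟩
    · have : pastField η (k + 1) = (pastField (fun (k : ℕ) (p : (ℕ → G) × (ℕ → G)) => p.1 k)
          (k + 1)).comap (fun ω => (fun k => η k ω, fun k => ξ k ω)) := by
        simp only [pastField, MeasurableSpace.comap_iSup, MeasurableSpace.comap_comp]
        rfl
      rw [this]
      exact ⟨t, ht, rfl⟩
  · rw [Measure.map_map (e2 k) hm]
    exact h.noise_law k
  · rw [pathLaw, Measure.map_map (measurable_pi_lambda _ e1) hm]
    rfl

end StochEq

/-! For (i), let `η'` be any solution. The law of `η' k` is the law of `noiseProd ξ k l * α l`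
convolved with that of `(α l)⁻¹ * η' (l + 1)`. Under (E1) and compactness, a limit in `l` gives
law(`η' k`) = law(`η k`) * V with one V for all `k` (`exists_map_eta_eq_mconv`). If the law of `η`
is a mixture with weights a, b > 0, each marginal ν thus satisfies ν = ν * W, where W = aV₁ + bV₂.
On a compact group this forces invariance of ν under W-almost every right translation, hence ν * V₁
= ν (`mconv_eq_self_of_absolutelyContinuous`). The first component then has the marginals of `η`,
and marginals determine the law of a solution (`IsSolution.pathLaw_eq`).

For (ii), (E3) allows a test function to be replaced by its average φ over left cosets of `H`. By
(E4) the variables `(α l)⁻¹ * η (l + 1)` approach `H` almost surely, where φ is the constant ∫ f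
dU_H; dominated convergence concludes. -/

open scoped ENNReal

namespace StochEq

/-- Convolution on a group is continuous for weak convergence. -/
theorem mconv_eq_of_tendsto {G : Type*} [Group G] [TopologicalSpace G] [IsTopologicalGroup G]
    [T2Space G] [SecondCountableTopology G] [MeasurableSpace G] [BorelSpace G]
    {ι : Type*} {L : Filter ι} {ν ρ : ι → ProbabilityMeasure G}
    {ν' ρ' : ProbabilityMeasure G} (hν : Tendsto ν L (𝓝 ν')) (hρ : Tendsto ρ L (𝓝 ρ'))
    {κ : ProbabilityMeasure G} (hκ : ∀ᶠ i in L, (ν i : Measure G).mconv (ρ i) = κ) [L.NeBot] :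
    (ν' : Measure G).mconv ρ' = κ := by
  have hm : Continuous fun p : G × G => p.1 * p.2 := continuous_mul
  have h := ((ProbabilityMeasure.continuous_map hm).tendsto (ν'.prod ρ')).comp
    ((ProbabilityMeasure.continuous_prod.tendsto (ν', ρ')).comp (hν.prodMk_nhds hρ))
  have h' : Tendsto (fun _ : ι => κ) L
      (𝓝 ((ν'.prod ρ').map hm.measurable.aemeasurable)) := h.congr' <| by
    filter_upwards [hκ] with i hi
    exact Subtype.ext hi
  have e : (ν'.prod ρ').map hm.measurable.aemeasurable = κ :=
    tendsto_nhds_unique h' tendsto_const_nhds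
  exact congrArg (fun π : ProbabilityMeasure G => (π : Measure G)) e

/-! ### Invariance under right convolution on a compact group -/

section CompactGroup

variable {G : Type*} [Group G] [TopologicalSpace G] [IsTopologicalGroup G] [CompactSpace G]
  [SecondCountableTopology G] [MeasurableSpace G] [BorelSpace G]

theorem integrable_of_continuous_of_compactSpace {X : Type*} [TopologicalSpace X] [CompactSpace X]
    [MeasurableSpace X] [BorelSpace X] (ν : Measure X) [IsFiniteMeasure ν] {f : X → ℝ}
    (hf : Continuous f) : Integrable f ν :=
  hf.integrable_of_hasCompactSupport (HasCompactSupport.of_compactSpace f)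

theorem continuous_integral_mul_right (ν : Measure G) [IsFiniteMeasure ν] {f : G → ℝ}
    (hf : Continuous f) : Continuous fun g => ∫ x, f (x * g) ∂ν := by
  simpa using continuous_parametric_integral_of_continuous (μ := ν) (s := Set.univ)
    (f := fun g x => f (x * g)) (by fun_prop) isCompact_univ

theorem integral_mconv_eq_integral_integral (ν ρ : Measure G) [IsFiniteMeasure ν]
    [IsFiniteMeasure ρ] {f : G → ℝ} (hf : Continuous f) :
    ∫ x, f x ∂(ν.mconv ρ) = ∫ w, ∫ x, f (x * w) ∂ν ∂ρ := by
  have hi : Integrable (fun p : G × G => f (p.1 * p.2)) (ν.prod ρ) :=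
    integrable_of_continuous_of_compactSpace _ (by fun_prop)
  rw [Measure.mconv, integral_map (by fun_prop) hf.aestronglyMeasurable, integral_prod_symm _ hi]

/-- A continuous function `F` on a compact group with `F g = ∫ F (w g) dW(w)` is invariant under
left translation by `W`-almost every `w`. -/
theorem ae_eq_of_eq_integral_mul (W : Measure G) [IsProbabilityMeasure W] {F : G → ℝ}
    (hF : Continuous F) (h : ∀ g, F g = ∫ w, F (w * g) ∂W) : ∀ᵐ w ∂W, F w = F 1 := by
  set m : Measure G := Measure.haar
  have hi : Integrable (fun p : G × G => (F (p.1 * p.2) - F p.2) ^ 2) (W.prod m) :=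
    integrable_of_continuous_of_compactSpace _ (by fun_prop)
  have hi1 : Integrable (fun p : G × G => F (p.1 * p.2) ^ 2) (W.prod m) :=
    integrable_of_continuous_of_compactSpace _ (by fun_prop)
  have hi2 : Integrable (fun p : G × G => 2 * (F (p.1 * p.2) * F p.2)) (W.prod m) :=
    integrable_of_continuous_of_compactSpace _ (by fun_prop)
  have hi3 : Integrable (fun p : G × G => F p.2 ^ 2) (W.prod m) :=
    integrable_of_continuous_of_compactSpace _ (by fun_prop)
  -- Left invariance of Haar measure makes each square contribute ∫ F²; the averaging identity makes
  -- the cross term 2 ∫ F².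
  have hzero : ∫ w, ∫ g, (F (w * g) - F g) ^ 2 ∂m ∂W = 0 := by
    have e1 : ∫ p, F (p.1 * p.2) ^ 2 ∂(W.prod m) = ∫ g, F g ^ 2 ∂m := by
      rw [integral_prod _ hi1]
      have : ∀ w, ∫ g, F (w * g) ^ 2 ∂m = ∫ g, F g ^ 2 ∂m := fun w =>
        integral_mul_left_eq_self (fun g => F g ^ 2) w
      simp [this]
    have e2 : ∫ p, 2 * (F (p.1 * p.2) * F p.2) ∂(W.prod m) = 2 * ∫ g, F g ^ 2 ∂m := by
      rw [integral_prod_symm _ hi2, ← integral_const_mul]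
      congr 1 with g
      simp only
      rw [integral_const_mul, integral_mul_const, ← h g, sq]
    have e3 : ∫ p, F p.2 ^ 2 ∂(W.prod m) = ∫ g, F g ^ 2 ∂m := by
      rw [integral_prod _ hi3]
      simp
    rw [← integral_prod (fun p : G × G => (F (p.1 * p.2) - F p.2) ^ 2) hi]
    have : ∀ p : G × G, (F (p.1 * p.2) - F p.2) ^ 2
        = F (p.1 * p.2) ^ 2 - 2 * (F (p.1 * p.2) * F p.2) + F p.2 ^ 2 := fun p => by ring
    simp_rw [this]
    rw [integral_add (f := fun p : G × G => F (p.1 * p.2) ^ 2 - 2 * (F (p.1 * p.2) * F p.2))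
      (hi1.sub hi2) hi3, integral_sub hi1 hi2, e1, e2, e3]
    ring
  rw [integral_eq_zero_iff_of_nonneg
    (fun w => integral_nonneg fun g => sq_nonneg _) hi.integral_prod_left] at hzero
  filter_upwards [hzero] with w hw
  -- Haar measure charges every nonempty open set, so vanishing for almost every g becomes vanishing
  -- for all g, in particular at g = 1.
  have hc : Continuous fun g => (F (w * g) - F g) ^ 2 := by fun_prop
  rw [Pi.zero_apply, integral_eq_zero_iff_of_nonneg (fun g => sq_nonneg _)
    (integrable_of_continuous_of_compactSpace _ hc), hc.ae_eq_iff_eq m continuous_zero] at hw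
  have := congrFun hw 1
  simp only [mul_one, Pi.zero_apply] at this
  exact sub_eq_zero.1 (pow_eq_zero_iff two_ne_zero |>.1 this)

/-- If `ν * W = ν` on a compact group, then `ν * V = ν` for each `V` absolutely continuous with
respect to `W`. -/
theorem mconv_eq_self_of_absolutelyContinuous [T2Space G] (ν W V : Measure G)
    [IsProbabilityMeasure ν] [IsProbabilityMeasure W] [IsProbabilityMeasure V]
    (h : ν.mconv W = ν) (hV : V ≪ W) : ν.mconv V = ν := by
  refine ext_of_forall_integral_eq_of_IsFiniteMeasure fun f => ?_
  have hf := f.continuous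
  -- Here F(g) = ∫ f(x g) dν(x); testing ν = ν * W on x ↦ f(x g) gives the averaging identity.
  have key := ae_eq_of_eq_integral_mul W (continuous_integral_mul_right ν hf) fun g => by
    conv_lhs => rw [← h]
    rw [integral_mconv_eq_integral_integral ν W (f := fun x => f (x * g)) (by fun_prop)]
    simp only [mul_assoc]
  rw [integral_mconv_eq_integral_integral ν V hf, integral_congr_ae (hV.ae_le key)]
  simp

end CompactGroup

/-! ### Transport of marginals and determination of the law of a solution -/

section Solution

theorem measurable_pastField {G Ω : Type*} [MeasurableSpace G] (η : ℕ → Ω → G) {k m : ℕ}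
    (h : k ≤ m) : Measurable[pastField η k] (η m) :=
  measurable_iff_comap_le.2 (le_iSup₂_of_le m h le_rfl)

theorem noiseProd_of_lt {G Ω : Type*} [Group G] (ξ : ℕ → Ω → G) {k l : ℕ} (h : l < k) (ω : Ω) :
    noiseProd ξ k l ω = 1 := by
  simp [noiseProd, List.Ico.eq_nil_of_le (Nat.succ_le_of_lt h)]

theorem noiseProd_of_le {G Ω : Type*} [Group G] (ξ : ℕ → Ω → G) {k l : ℕ} (h : k ≤ l) (ω : Ω) :
    noiseProd ξ k l ω = ξ k ω * noiseProd ξ (k + 1) l ω := by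
  simp [noiseProd, List.Ico.eq_cons (Nat.lt_succ_of_le h)]

variable {G : Type*} [Group G] [MeasurableSpace G]
  {Ω : Type*} [MeasurableSpace Ω] {P : Measure Ω}
  {μ : ℕ → ProbabilityMeasure G} {η ξ : ℕ → Ω → G}

theorem IsSolution.indepFun_of_measurable {β : Type*} [MeasurableSpace β]
    (h : IsSolution P μ η ξ) (k : ℕ) {Y : Ω → β} (hY : Measurable[pastField η (k + 1)] Y) :
    IndepFun (ξ k) Y P :=
  (IndepFun_iff_Indep _ _ _).2 (indep_of_indep_of_le_right (h.indep k) hY.comap_le)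

theorem IsSolution.pastField_le (h : IsSolution P μ η ξ) (k : ℕ) :
    pastField η k ≤ (inferInstance : MeasurableSpace Ω) :=
  iSup₂_le fun m _ => (h.measurable_eta m).comap_le

theorem IsSolution.ae_noiseProd_mul (h : IsSolution P μ η ξ) {k l : ℕ} (hkl : k ≤ l + 1) :
    ∀ᵐ ω ∂P, noiseProd ξ k l ω * η (l + 1) ω = η k ω := by
  induction hkl using Nat.decreasingInduction with
  | self => simp [noiseProd_of_lt ξ (Nat.lt_succ_self l)]
  | of_succ k hk ih =>
    filter_upwards [ih, h.equation k] with ω h1 h2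
    rw [noiseProd_of_le ξ (Nat.le_of_lt_succ hk), mul_assoc, h1, h2]

variable [MeasurableMul₂ G]

theorem IsSolution.measurable_noiseProd (h : IsSolution P μ η ξ) (k l : ℕ) :
    Measurable (noiseProd ξ k l) := by
  have h1 : ∀ L : List ℕ, Measurable fun ω => (L.map fun i => ξ i ω).prod := fun L => by
    induction L with
    | nil => simp
    | cons i L ih => simpa using! (h.measurable_xi i).mul ih
  exact h1 _

variable [IsProbabilityMeasure P]

/-- Independence of the noise variables among themselves is not part of the definition. It is
recovered here because the later product is almost surely `η (k + 1) * (η (l + 1))⁻¹`, a function of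
the past. -/
theorem IsSolution.map_noiseProd [MeasurableInv G] (h : IsSolution P μ η ξ) {k l : ℕ}
    (hkl : k ≤ l) : P.map (noiseProd ξ k l)
      = (μ k : Measure G).mconv (P.map (noiseProd ξ (k + 1) l)) := by
  have hY : Measurable[pastField η (k + 1)] fun ω => η (k + 1) ω * (η (l + 1) ω)⁻¹ :=
    Measurable.mul (measurable_pastField η le_rfl)
      (Measurable.inv (measurable_pastField η (Nat.succ_le_succ hkl)))
  have hae : (fun ω => η (k + 1) ω * (η (l + 1) ω)⁻¹) =ᵐ[P] noiseProd ξ (k + 1) l := by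
    filter_upwards [h.ae_noiseProd_mul (Nat.succ_le_succ hkl)] with ω hω
    rw [← hω, mul_inv_cancel_right]
  have hind : IndepFun (ξ k) (noiseProd ξ (k + 1) l) P :=
    (h.indepFun_of_measurable k hY).congr (ae_eq_refl _) hae
  rw [← h.noise_law k,
    ← hind.map_mul_eq_map_mconv_map (h.measurable_xi k) (h.measurable_noiseProd _ _)]
  congr 1
  ext ω
  exact noiseProd_of_le ξ hkl ω

theorem IsSolution.map_eta (h : IsSolution P μ η ξ) (k : ℕ) :
    P.map (η k) = (μ k : Measure G).mconv (P.map (η (k + 1))) := by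
  rw [← h.noise_law k, ← (h.indepFun_of_measurable k
    (measurable_pastField η le_rfl)).map_mul_eq_map_mconv_map (h.measurable_xi k)
    (h.measurable_eta _)]
  exact Measure.map_congr (h.equation k)

/-- The marginals of all solutions are transported by the laws of the noise products of one of
them. -/
theorem IsSolution.map_eta_eq_mconv [MeasurableInv G] {Ω' : Type*} [MeasurableSpace Ω']
    {P' : Measure Ω'} [IsProbabilityMeasure P'] {η' ξ' : ℕ → Ω' → G}
    (h : IsSolution P μ η ξ) (h' : IsSolution P' μ η' ξ') {k l : ℕ} (hkl : k ≤ l + 1) :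
    P'.map (η' k) = (P.map (noiseProd ξ k l)).mconv (P'.map (η' (l + 1))) := by
  have := fun k => Measure.isProbabilityMeasure_map (μ := P') (h'.measurable_eta k).aemeasurable
  have := fun k => Measure.isProbabilityMeasure_map (μ := P) (h.measurable_noiseProd k l).aemeasurable
  induction hkl using Nat.decreasingInduction with
  | self =>
    have : noiseProd ξ (l + 1) l = fun _ => 1 :=
      funext (noiseProd_of_lt ξ (Nat.lt_succ_self l))
    simp [this]
  | of_succ k hk ih =>
    rw [h'.map_eta, ih, h.map_noiseProd (Nat.le_of_lt_succ hk), Measure.mconv_assoc]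

/-- Prepends to the sequence `p.2` the product of `p.1` and its first term. -/
def consMul (p : G × (ℕ → G)) : ℕ → G :=
  fun j => Nat.casesOn j (p.1 * p.2 0) p.2

theorem measurable_consMul : Measurable (consMul : G × (ℕ → G) → ℕ → G) :=
  measurable_pi_lambda _ fun j => by
    cases j <;> simp only [consMul] <;> fun_prop

/-- Freezing the path at index `n` gives the recursion in `k` a starting point: at `k = n` the path
is the constant sequence `η n`, whose law depends on one marginal only. -/
theorem IsSolution.map_truncated (h : IsSolution P μ η ξ) {k n : ℕ} (hkn : k < n) :
    P.map (fun ω j => η (min (k + j) n) ω) = ((μ k : Measure G).prod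
      (P.map fun ω j => η (min (k + 1 + j) n) ω)).map consMul := by
  have hY : Measurable[pastField η (k + 1)] fun ω j => η (min (k + 1 + j) n) ω :=
    @measurable_pi_lambda _ _ _ (pastField η (k + 1)) _ _ fun j => measurable_pastField η (by omega)
  have hY' := hY.mono (h.pastField_le _) le_rfl
  rw [← h.noise_law k, ← (indepFun_iff_map_prod_eq_prod_map_map
    (h.measurable_xi k).aemeasurable hY'.aemeasurable).1 (h.indepFun_of_measurable k hY),
    Measure.map_map measurable_consMul ((h.measurable_xi k).prodMk hY')]
  refine Measure.map_congr ?_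
  filter_upwards [h.equation k] with ω hω
  funext j
  cases j with
  | zero => simpa [consMul, min_eq_left hkn.le, min_eq_left (Nat.succ_le_of_lt hkn)] using hω
  | succ j => simp [consMul, add_assoc, add_comm 1 j]

/-- The law of a solution is determined by its marginals. -/
theorem IsSolution.pathLaw_eq {Ω' : Type*} [MeasurableSpace Ω']
    {P' : Measure Ω'} [IsProbabilityMeasure P'] {η' ξ' : ℕ → Ω' → G}
    (h : IsSolution P μ η ξ) (h' : IsSolution P' μ η' ξ')
    (hm : ∀ k, P.map (η k) = P'.map (η' k)) : pathLaw P η = pathLaw P' η' := by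
  have hη := measurable_pi_lambda _ h.measurable_eta
  have hη' := measurable_pi_lambda _ h'.measurable_eta
  have hconst : Measurable fun (g : G) (_ : ℕ) => g := measurable_pi_lambda _ fun _ => measurable_id
  have htrunc : ∀ n k, k ≤ n → P.map (fun ω j => η (min (k + j) n) ω)
      = P'.map (fun ω j => η' (min (k + j) n) ω) := fun n k hk => by
    induction hk using Nat.decreasingInduction with
    | self =>
      have := congrArg (Measure.map fun (g : G) (_ : ℕ) => g) (hm n)
      rw [Measure.map_map hconst (h.measurable_eta n),
        Measure.map_map hconst (h'.measurable_eta n)] at this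
      simpa [Function.comp_def] using this
    | of_succ k hk ih => rw [h.map_truncated hk, h'.map_truncated hk, ih]
  have : IsProbabilityMeasure (pathLaw P' η') := Measure.isProbabilityMeasure_map hη'.aemeasurable
  refine IsProjectiveLimit.unique (P := fun I => (pathLaw P' η').map I.restrict) (fun I => ?_)
    fun I => rfl
  have hr : Measurable fun (x : ℕ → G) (i : I) => x i := by fun_prop
  -- Freezing at the largest index of `I` leaves the coordinates in `I` unchanged.
  have hI : ∀ i : I, min (0 + (i : ℕ)) (I.sup id) = i := fun i => by
    rw [zero_add]
    exact min_eq_left (Finset.le_sup (f := id) i.2)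
  have := congrArg (Measure.map fun (x : ℕ → G) (i : I) => x i) (htrunc (I.sup id) 0 (Nat.zero_le _))
  rw [Measure.map_map hr (measurable_pi_lambda _ fun _ => h.measurable_eta _),
    Measure.map_map hr (measurable_pi_lambda _ fun _ => h'.measurable_eta _)] at this
  simp only [Function.comp_def, hI] at this
  have e := Measure.map_map (μ := P) hr hη
  have e' := Measure.map_map (μ := P') hr hη'
  exact e.trans (this.trans e'.symm)

end Solution
/-- A continuous function constant on the left cosets of a compact subgroup `H` has limit its
value at `1` along every `x` for which `x⁻¹ H` tends to `H`. -/
theorem tendsto_of_tendsto_mk_inv {G : Type*} [Group G] [TopologicalSpace G]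
    [IsTopologicalGroup G] {H : Subgroup G} [CompactSpace H] {φ : G → ℝ}
    (hφ : Continuous φ) (hinv : ∀ g, ∀ h ∈ H, φ (g * h) = φ g) {ι : Type*} {L : Filter ι}
    {x : ι → G} (hx : Tendsto (fun i => (((x i)⁻¹ : G) : G ⧸ H)) L (𝓝 ((1 : G) : G ⧸ H))) :
    Tendsto (fun i => φ (x i)) L (𝓝 (φ 1)) := by
  refine tendsto_def.2 fun s hs => ?_
  obtain ⟨t, hts, ht, h1t⟩ := mem_nhds_iff.1 hs
  have hH : (H : Set G) ⊆ φ ⁻¹' t := fun h hh => by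
    simpa [Set.mem_preimage, ← hinv 1 h hh] using h1t
  -- Compactness of `H` gives a uniform neighbourhood: `H * U` lies in the preimage of `t`. The
  -- hypothesis eventually puts `x i` in `H * U`.
  obtain ⟨U, hU, hUt⟩ := compact_open_separated_mul_right
    (isCompact_iff_compactSpace.2 inferInstance) (ht.preimage hφ) hH
  have hU' : ((↑) : G → G ⧸ H) '' U⁻¹ ∈ 𝓝 ((1 : G) : G ⧸ H) := by
    rw [QuotientGroup.nhds_eq]
    exact image_mem_map (inv_mem_nhds_one G hU)
  filter_upwards [mem_map.1 (hx hU')] with i hi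
  obtain ⟨u, hu, hui⟩ := hi
  have hmem : u⁻¹ * (x i)⁻¹ ∈ H := QuotientGroup.eq.1 hui
  refine hts (hUt ⟨x i * u, ?_, u⁻¹, hu, by simp⟩)
  simpa using H.inv_mem hmem

/-! ### Extremality and convergence to Haar measure -/

section Main

variable {G : Type*} [Group G] [TopologicalSpace G] [IsTopologicalGroup G] [CompactSpace G]
  [T2Space G] [SecondCountableTopology G] [MeasurableSpace G] [BorelSpace G]
  {Ω : Type*} [MeasurableSpace Ω] {P : Measure Ω} [IsProbabilityMeasure P]
  {μ : ℕ → ProbabilityMeasure G} {η ξ : ℕ → Ω → G}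

/-- Under `CondE1`, the marginals of every solution are obtained from those of `η` by a right
convolution. -/
theorem exists_map_eta_eq_mconv (h : IsSolution P μ η ξ) {α : ℕ → G} (h1 : CondE1 P η ξ α)
    {Ω' : Type*} [MeasurableSpace Ω'] {P' : Measure Ω'} [IsProbabilityMeasure P']
    {η' ξ' : ℕ → Ω' → G} (h' : IsSolution P' μ η' ξ') :
    ∃ V : ProbabilityMeasure G, ∀ k, P'.map (η' k) = (P.map (η k)).mconv V := by
  have hη := fun k => Measure.isProbabilityMeasure_map (μ := P) (h.measurable_eta k).aemeasurable
  have hη' := fun k =>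
    Measure.isProbabilityMeasure_map (μ := P') (h'.measurable_eta k).aemeasurable
  let U : Ultrafilter ℕ := hyperfilter ℕ
  have hU : (U : Filter ℕ) ≤ atTop := by
    simpa [Nat.cofinite_eq_atTop] using hyperfilter_le_cofinite (α := ℕ)
  let ρ : ℕ → ProbabilityMeasure G := fun l =>
    ⟨P'.map fun ω => (α l)⁻¹ * η' (l + 1) ω,
      Measure.isProbabilityMeasure_map ((h'.measurable_eta _).const_mul _).aemeasurable⟩
  -- Probability measures on a compact metrizable group form a compact space. The limit is chosen
  -- before `k`, so the same `V` serves every marginal.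
  obtain ⟨V, -, hV⟩ := isCompact_univ.ultrafilter_le_nhds (U.map ρ) (by simp)
  refine ⟨V, fun k => Eq.symm ?_⟩
  refine mconv_eq_of_tendsto (L := (U : Filter ℕ)) (κ := ⟨_, hη' k⟩)
    ((h1 k).tendsto.mono_left hU) hV ?_
  filter_upwards [hU (eventually_ge_atTop k)] with l hl
  have e1 : P.map (fun ω => noiseProd ξ k l ω * α l)
      = (P.map (noiseProd ξ k l)).mconv (Measure.dirac (α l)) := by
    rw [Measure.mconv_dirac, Measure.map_map (by fun_prop) (h.measurable_noiseProd k l)]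
    rfl
  have e2 : P'.map (fun ω => (α l)⁻¹ * η' (l + 1) ω)
      = (Measure.dirac (α l)⁻¹).mconv (P'.map (η' (l + 1))) := by
    rw [Measure.dirac_mconv, Measure.map_map (by fun_prop) (h'.measurable_eta _)]
    rfl
  have := hη' (l + 1)
  have := Measure.isProbabilityMeasure_map (μ := P) (h.measurable_noiseProd k l).aemeasurable
  simp only [ρ, ProbabilityMeasure.coe_mk]
  rw [e1, e2, Measure.mconv_assoc, ← Measure.mconv_assoc (Measure.dirac _),
    Measure.dirac_mconv_dirac, mul_inv_cancel, Measure.dirac_one_mconv,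
    ← h.map_eta_eq_mconv h' (Nat.le_succ_of_le hl)]

theorem isExtremal_of_condE1 (h : IsSolution P μ η ξ) {α : ℕ → G} (h1 : CondE1 P η ξ α) :
    IsExtremal P μ η := by
  have hη := fun k => Measure.isProbabilityMeasure_map (μ := P) (h.measurable_eta k).aemeasurable
  refine mem_extremePoints_iff_left.2 ⟨pathLaw_mem_solutionLaws P μ η ξ h, ?_⟩
  rintro _ ⟨Ω₁, _, P₁, _, η₁, ξ₁, hs₁, rfl⟩ _ ⟨Ω₂, _, P₂, _, η₂, ξ₂, hs₂, rfl⟩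
    ⟨a, b, ha, hb, hab, hmix⟩
  refine hs₁.pathLaw_eq h fun k => ?_
  obtain ⟨V₁, hV₁⟩ := exists_map_eta_eq_mconv h h1 hs₁
  obtain ⟨V₂, hV₂⟩ := exists_map_eta_eq_mconv h h1 hs₂
  have hmarg : a • P₁.map (η₁ k) + b • P₂.map (η₂ k) = P.map (η k) := by
    have hk : Measurable fun x : ℕ → G => x k := measurable_pi_apply k
    have := congrArg (Measure.map fun x : ℕ → G => x k) hmix
    rw [Measure.map_add _ _ hk, Measure.map_smul, Measure.map_smul, pathLaw, pathLaw, pathLaw,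
      Measure.map_map hk (measurable_pi_lambda _ hs₁.measurable_eta),
      Measure.map_map hk (measurable_pi_lambda _ hs₂.measurable_eta),
      Measure.map_map hk (measurable_pi_lambda _ h.measurable_eta)] at this
    exact this
  let W : Measure G := (a : ℝ≥0∞) • (V₁ : Measure G) + (b : ℝ≥0∞) • (V₂ : Measure G)
  have : IsProbabilityMeasure W := ⟨by
    simp only [W, Measure.add_apply, Measure.smul_apply, smul_eq_mul, measure_univ, mul_one]
    exact_mod_cast hab⟩
  have hW : (P.map (η k)).mconv W = P.map (η k) := by
    conv_rhs => rw [← hmarg, hV₁ k, hV₂ k]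
    rw [Measure.mconv_add, Measure.mconv_smul_right, Measure.mconv_smul_right]
    rfl
  -- The strict positivity of the weight `a` enters here.
  have hac : (V₁ : Measure G) ≪ W := fun s hs => by
    simp only [W, Measure.add_apply, Measure.smul_apply, smul_eq_mul, add_eq_zero, mul_eq_zero,
      ENNReal.coe_eq_zero, ha.ne', false_or] at hs
    exact hs.1
  rw [hV₁ k, mconv_eq_self_of_absolutelyContinuous _ W _ hW hac]

theorem condE2_of_condE3_of_condE4 (h : IsSolution P μ η ξ) {α : ℕ → G} {H : Subgroup G}
    [CompactSpace H] (h3 : CondE3 P η H) (h4 : CondE4 P η ξ α H) : CondE2 P η α H := by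
  have hmeas : ∀ l, Measurable fun ω => (α l)⁻¹ * η (l + 1) ω :=
    fun l => (h.measurable_eta _).const_mul _
  refine ⟨fun l => (hmeas l).aemeasurable, continuous_subtype_val.aemeasurable, ?_⟩
  refine ProbabilityMeasure.tendsto_iff_forall_integral_tendsto.2 fun f => ?_
  let U : Measure H := normalizedHaar H
  have : U.IsHaarMeasure := inferInstanceAs (Measure.haarMeasure _).IsHaarMeasure
  let φ : G → ℝ := fun g => ∫ x : H, f (g * x) ∂U
  have hφ : Continuous φ := by
    simpa using continuous_parametric_integral_of_continuous (μ := U) (s := Set.univ)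
      (f := fun (g : G) (x : H) => f (g * x)) (by fun_prop) isCompact_univ
  have hinv : ∀ g, ∀ x ∈ H, φ (g * x) = φ g := fun g x hx => by
    simpa [φ, mul_assoc] using
      integral_mul_left_eq_self (μ := U) (fun y : H => f (g * y)) ⟨x, hx⟩
  have hbound : ∀ g, ‖φ g‖ ≤ ‖f‖ := fun g => by
    simpa using norm_integral_le_of_norm_le_const (μ := U)
      (ae_of_all _ fun x : H => f.norm_coe_le_norm (g * x))
  -- By (E3) every right shift by an element of `H` leaves the integral unchanged; averaging over
  -- `H` and Fubini replace `f` by `φ`.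
  have hlaw : ∀ l, ∫ ω, f ((α l)⁻¹ * η (l + 1) ω) ∂P = ∫ ω, φ ((α l)⁻¹ * η (l + 1) ω) ∂P := by
    intro l
    have hshift : ∀ x : H, ∫ ω, f ((α l)⁻¹ * η (l + 1) ω * x) ∂P
        = ∫ ω, f ((α l)⁻¹ * η (l + 1) ω) ∂P := fun x => by
      have hf : AEStronglyMeasurable (fun g => f ((α l)⁻¹ * g)) (P.map (η (l + 1))) :=
        (f.continuous.comp (continuous_const_mul _)).aestronglyMeasurable
      have e1 := integral_map (h.measurable_eta (l + 1)).aemeasurable hf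
      rw [← h3 x x.2 (l + 1)] at e1 hf
      rw [integral_map ((h.measurable_eta (l + 1)).mul_const _).aemeasurable hf] at e1
      simpa [mul_assoc] using e1
    have hint : Integrable (fun p : Ω × H => f ((α l)⁻¹ * η (l + 1) p.1 * p.2)) (P.prod U) := by
      refine Integrable.of_bound (C := ‖f‖) ?_ (ae_of_all _ fun p => f.norm_coe_le_norm _)
      refine (f.continuous.measurable.comp ?_).aestronglyMeasurable
      exact ((hmeas l).comp measurable_fst).mul (measurable_subtype_coe.comp measurable_snd)
    simp only [φ]
    rw [integral_integral_swap hint]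
    simp [hshift, U]
  have hlim : ∀ᵐ ω ∂P, Tendsto (fun l => φ ((α l)⁻¹ * η (l + 1) ω)) atTop (𝓝 (φ 1)) := by
    filter_upwards [h4 0, ae_all_iff.2 fun l => h.ae_noiseProd_mul (Nat.zero_le (l + 1))]
      with ω hω hprod
    refine tendsto_of_tendsto_mk_inv hφ hinv ?_
    -- Translating (E4) at time 0 by `(η 0 ω)⁻¹` yields the coset of the inverse of `(α l)⁻¹ * η (l
    -- + 1) ω`, since `η 0` is the noise product times `η (l + 1)`.
    have hc : Continuous fun q : G ⧸ H => (η 0 ω)⁻¹ • q := continuous_const_smul _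
    have hlim : Tendsto (fun l => (((η 0 ω)⁻¹ * (noiseProd ξ 0 l ω * α l) : G) : G ⧸ H)) atTop
        (𝓝 (((η 0 ω)⁻¹ * η 0 ω : G) : G ⧸ H)) := (hc.tendsto _).comp hω
    rw [inv_mul_cancel] at hlim
    refine hlim.congr fun l => ?_
    rw [← hprod l, mul_inv_rev, mul_inv_rev, inv_inv, ← mul_assoc, inv_mul_cancel_right]
  have hdom := tendsto_integral_of_dominated_convergence (μ := P) (fun _ => ‖f‖)
    (fun l => (hφ.measurable.comp (hmeas l)).aestronglyMeasurable) (integrable_const _)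
    (fun l => ae_of_all _ fun ω => hbound _) hlim
  have hright : ∫ g, f g ∂(U.map fun x : H => (x : G)) = φ 1 := by
    rw [integral_map continuous_subtype_val.aemeasurable f.continuous.aestronglyMeasurable]
    simp [φ]
  simp only [ProbabilityMeasure.coe_mk]
  rw [hright]
  simp_rw [integral_map (hmeas _).aemeasurable f.continuous.aestronglyMeasurable, hlaw]
  simpa using hdom

end Main

end StochEq

theorem mainTheorem7 {G : Type*} [Group G] [TopologicalSpace G] [IsTopologicalGroup G]
    [CompactSpace G] [T2Space G] [SecondCountableTopology G] [MeasurableSpace G] [BorelSpace G]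
    {Ω : Type*} [MeasurableSpace Ω] (P : Measure Ω) [IsProbabilityMeasure P]
    (μ : ℕ → ProbabilityMeasure G) (η ξ : ℕ → Ω → G) (hsol : StochEq.IsSolution P μ η ξ) :
    (∀ α : ℕ → G, StochEq.CondE1 P η ξ α → StochEq.IsExtremal P μ η) ∧
    (∀ (α : ℕ → G) (H : Subgroup G) [CompactSpace H],
      StochEq.CondE1 P η ξ α → StochEq.CondE3 P η H → StochEq.CondE4 P η ξ α H →
        StochEq.CondE2 P η α H) :=
  ⟨fun _ h1 => StochEq.isExtremal_of_condE1 hsol h1,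
    fun _ _ _ _ h3 h4 => StochEq.condE2_of_condE3_of_condE4 hsol h3 h4⟩
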